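/- Fix $p$ and let $X_1,X_2,\dots$ be i.i.d. $\mathcal N(0,\Sigma_0)$ in $\mathbb R^p$ with $\Sigma_0$ positive definite; let $\Theta_0=\Sigma_0^{-1}$ and let $X$ be the $n\times p$ matrix whose rows are the first $n$ observations, with columns $x_1,\dots,x_p$. *Parameters.* A parameter is a vector $\nu=\mathrm{vec}(R+\Phi)\in\mathbb R^{p^2}$ with $R=\mathrm{diag}(\rho_1,\dots,\rho_p)$ and $\Phi=(\varphi_{ij})=[\varphi_1|\cdots|\varphi_p]$ having zero diagonal. It is a DAG if all $\rho_j>0$ and the directed graph with an edge $i\to j$ whenever $\varphi_{ij}\neq0$ is acyclic; $\mathcal D$ is the set of DAGs, and $\mathcal E_0=\{\nu\in\mathcal D:(R-\Phi)(R-\Phi)^T=\Theta_0\}$. The log-likelihood (up to a constant) and the penalized log-likelihood are $$\ell_n(\nu)=\sum_{j=1}^p\Big[n\log\rho_j-\tfrac12\|\rho_jx_j-X\varphi_j\|^2\Big],\qquad F(\nu)=\ell_n(\nu)-n\sum_{i\ne j}p_{\lambda_n}(|\varphi_{ij}|).$$ *Penalty.* Each $p_{\lambda_n}:[0,\infty)\to\mathbb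 R$ is concave and nondecreasing with $p_{\lambda_n}(0)=0$, and the slopes at the origin are bounded: there is $K$ with $p_{\lambda_n}(t)\le Kt$ for all $t\ge0$ and all large $n$. Let $\tau(\lambda_n)=\sup_{t\ge0}p_{\lambda_n}(t)\in[0,\infty]$. For a DAG $\nu$ let $$a_n(\nu)=\max_{\varphi_{ij}\ne0}|p_{\lambda_n}'(|\varphi_{ij}|)|,\quad b_n(\nu)=\max_{\varphi_{ij}\neq0}|p_{\lambda_n}''(|\varphi_{ij}|)|,\quad c_n(\nu)=\min_{\varphi_{ij}\neq0}p_{\lambda_n}(|\varphi_{ij}|)$$ (for large $n$, $p_{\lambda_n}$ is assumed twice differentiable at the points that occur; if $\nu$ has no edge, then $a_n=b_n=0$ and conditions on $c_n(\nu)$ are void). *Theorem.* Let $\nu^*\in\mathcal E_0$ have the fewest edges among all elements of $\mathcal E_0$, and let $\nu_0\in\mathcal E_0$ have strictly more edges than $\nu^*$. Assume that 1. $\liminf_{n\to\infty}\liminf_{t\to0^+}p_{\lambda_n}'(t)/\lambda_n>0$, $\lambda_n\to0$ and $\lambda_n n^{1/2}\to\infty$; 2. $a_n(\nu)=O(n^{-1/2})$,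 $b_n(\nu)\to0$ and $c_n(\nu)=\tau(\lambda_n)+O(n^{-1/2})$ for both $\nu=\nu_0$ and $\nu=\nu^*$ (in particular this holds if it is assumed for every $\nu\in\mathcal E_0$); 3. $\limsup_n\tau(\lambda_n)<\infty$ and $\tau(\lambda_n)n^{1/2}\to\infty$. Let $\widehat\nu_n$ and $\widehat\nu_n^*$ be any random vectors that, with probability tending to one, are local maximizers of $F$ over $\mathcal D$, and that satisfy $\|\widehat\nu_n-\nu_0\|=O_P(n^{-1/2}+a_n(\nu_0))$ and $\|\widehat\nu_n^*-\nu^*\|=O_P(n^{-1/2}+a_n(\nu^*))$. Then $$P\big(F(\widehat\nu_n^*)>F(\widehat\nu_n)\big)\to1\qquad(n\to\infty).$$ -/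

import Mathlib

open MeasureTheory ProbabilityTheory Filter Topology Set

noncomputable section

namespace PenalizedDAG

/-- The parameter `ν = vec(U)` with `U = R + Φ`, a vector of `ℝ^{p²}` with its Euclidean norm;
`ν (i, j)` is the entry `u_{ij}`. Here `p` is the number of variables. -/
abbrev Param (p : ℕ) : Type := EuclideanSpace ℝ (Fin p × Fin p)

variable {p : ℕ}

/-- The diagonal part `R = diag(ρ₁, …, ρ_p)` of `U`. -/
def Rmat (ν : Param p) : Matrix (Fin p) (Fin p) ℝ :=
  Matrix.diagonal fun j => ν (j, j)

/-- The off-diagonal part `Φ = (φ_{ij})` of `U`: the weighted adjacency matrix. -/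
def Phi (ν : Param p) : Matrix (Fin p) (Fin p) ℝ :=
  Matrix.of fun i j => if i = j then 0 else ν (i, j)

/-- The directed graph with an edge `i → j` whenever `A i j ≠ 0` has no directed cycle. -/
def IsDAG (A : Matrix (Fin p) (Fin p) ℝ) : Prop :=
  ∀ i, ¬ Relation.TransGen (fun k l => A k l ≠ 0) i i

/-- The space `𝒟` of DAGs: `Φ` is acyclic and every `ρ_j` is positive. -/
def dagSpace (p : ℕ) : Set (Param p) :=
  {ν | IsDAG (Phi ν) ∧ ∀ j, 0 < ν (j, j)}

/-- The inverse covariance matrix `Θ(ν) = (R - Φ)(R - Φ)ᵀ`. -/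
def Theta (ν : Param p) : Matrix (Fin p) (Fin p) ℝ :=
  (Rmat ν - Phi ν) * (Rmat ν - Phi ν).transpose

/-- The equivalence class `ℰ(Θ₀)` of all DAGs that represent the inverse covariance `Θ₀`. -/
def equivClass (Θ₀ : Matrix (Fin p) (Fin p) ℝ) : Set (Param p) :=
  {ν | ν ∈ dagSpace p ∧ Theta ν = Θ₀}

/-- The set of edges of `ν`, i.e. the support of `Φ`. -/
def edges (ν : Param p) : Set (Fin p × Fin p) :=
  {e | Phi ν e.1 e.2 ≠ 0}

/-- The number of edges of `ν`. -/
def numEdges (ν : Param p) : ℕ := (edges ν).ncard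

/-- `ν` is a DAG with the fewest edges in `ℰ(Θ₀)`. -/
def IsSparsest (Θ₀ : Matrix (Fin p) (Fin p) ℝ) (ν : Param p) : Prop :=
  ν ∈ equivClass Θ₀ ∧ ∀ ν' ∈ equivClass Θ₀, numEdges ν ≤ numEdges ν'

/-- The Gaussian log-likelihood
`ℓ_n(ν | X) = ∑_j (n log ρ_j - ‖ρ_j x_j - X φ_j‖² / 2)` of an `n × p` data matrix `X`
(up to an additive constant that does not depend on `ν`). -/
def logLik {n : ℕ} (X : Matrix (Fin n) (Fin p) ℝ) (ν : Param p) : ℝ :=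
  ∑ j, ((n : ℝ) * Real.log (ν (j, j))
    - (1 / 2) * ‖WithLp.toLp 2 (fun k => ν (j, j) * X k j - ∑ i, X k i * Phi ν i j)‖ ^ 2)

/-- The penalty `∑_{i ≠ j} q(|u_{ij}|)` of `ν`, for a penalty function `q`. -/
def penalty (q : ℝ → ℝ) (ν : Param p) : ℝ :=
  ∑ e : Fin p × Fin p, if e.1 = e.2 then 0 else q |ν e|

/-- The penalized log-likelihood `F(ν) = ℓ_n(ν | X) - n q(ν)`. -/
def objective {n : ℕ} (q : ℝ → ℝ) (X : Matrix (Fin n) (Fin p) ℝ) (ν : Param p) : ℝ :=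
  logLik X ν - n * penalty q ν

/-- The `n × p` data matrix whose rows are the first `n` observations. -/
def dataMatrix {Ω : Type*} (X : ℕ → Ω → EuclideanSpace ℝ (Fin p)) (n : ℕ) (ω : Ω) :
    Matrix (Fin n) (Fin p) ℝ :=
  Matrix.of fun k j => X k ω j

/-- `a(ν) = max {|q'(|φ_{ij}|)| : φ_{ij} ≠ 0}` (and `0` if there is no edge). -/
def aMax (q : ℝ → ℝ) (ν : Param p) : ℝ :=
  ⨆ e : edges ν, |deriv q (abs (Phi ν e.1.1 e.1.2))|

/-- `b(ν) = max {|q''(|φ_{ij}|)| : φ_{ij} ≠ 0}` (and `0` if there is no edge). -/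
def bMax (q : ℝ → ℝ) (ν : Param p) : ℝ :=
  ⨆ e : edges ν, |deriv (deriv q) (abs (Phi ν e.1.1 e.1.2))|

/-- `c(ν) = min {q(|φ_{ij}|) : φ_{ij} ≠ 0}`; only used for `ν` with at least one edge. -/
def cMin (q : ℝ → ℝ) (ν : Param p) : ℝ :=
  ⨅ e : edges ν, q (abs (Phi ν e.1.1 e.1.2))

/-- `τ = sup_{t ≥ 0} q(t)`, possibly `+∞`. -/
def tau (q : ℝ → ℝ) : EReal := ⨆ t ∈ Ici (0 : ℝ), ((q t : ℝ) : EReal)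

/-- The rate `n^{-1/2}`. -/
def rate (n : ℕ) : ℝ := (n : ℝ) ^ (-(1 / 2) : ℝ)

/-- `Y_n = O_P(r_n)` for real random variables `Y_n` and a deterministic sequence `r_n`. -/
def IsBigOP {Ω : Type*} [MeasurableSpace Ω] (P : Measure Ω) (Y : ℕ → Ω → ℝ) (r : ℕ → ℝ) : Prop :=
  ∀ ε : ENNReal, 0 < ε → ∃ C : ℝ, ∀ᶠ n in atTop, P {ω | C * r n < |Y n ω|} ≤ ε

/-- The conditions on the penalties `q n = p_{λ_n}` at the DAG `ν`:
they are twice differentiable at the absolute values of the nonzero coefficients of `ν` for all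
large `n`, `a_n(ν) = O(n^{-1/2})`, and `b_n(ν) → 0`. -/
structure SmoothAt (q : ℕ → ℝ → ℝ) (ν : Param p) : Prop where
  diff : ∀ᶠ n in atTop, ∀ e ∈ edges ν, DifferentiableAt ℝ (q n) (abs (Phi ν e.1 e.2)) ∧
    DifferentiableAt ℝ (deriv (q n)) (abs (Phi ν e.1 e.2))
  a_rate : (fun n => aMax (q n) ν) =O[atTop] rate
  b_tendsto : Tendsto (fun n => bMax (q n) ν) atTop (𝓝 0)

/-- `c_n(ν) = τ(λ_n) + O(n^{-1/2})` (no condition if `ν` has no edge). -/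
def NearlyFlatAt (q : ℕ → ℝ → ℝ) (ν : Param p) : Prop :=
  (edges ν).Nonempty → (fun n => cMin (q n) ν - (tau (q n)).toReal) =O[atTop] rate

/-- `νhat` is a sequence of consistent local maximizers of `F` over `𝒟` around `ν`: with
probability tending to one `νhat n` is a local maximizer of `F` in `𝒟`, and
`‖νhat n - ν‖ = O_P(n^{-1/2} + a_n(ν))`. -/
structure IsConsistentLocalMax {Ω : Type*} [MeasurableSpace Ω] (P : Measure Ω)
    (X : ℕ → Ω → EuclideanSpace ℝ (Fin p)) (q : ℕ → ℝ → ℝ) (ν : Param p)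
    (νhat : ℕ → Ω → Param p) : Prop where
  measurable : ∀ n, Measurable (νhat n)
  localMax : Tendsto (fun n => P {ω | ¬ (νhat n ω ∈ dagSpace p ∧
    IsLocalMaxOn (objective (q n) (dataMatrix X n ω)) (dagSpace p) (νhat n ω))}) atTop (𝓝 0)
  consistent : IsBigOP P (fun n ω => ‖νhat n ω - ν‖) (fun n => rate n + aMax (q n) ν)

end PenalizedDAG

end

/-!
The proof compares orders of magnitude in
`F(ν̂*) - F(ν̂) = (ℓ(ν̂*) - ℓ(ν̂)) + n (pen(ν̂) - pen(ν̂*))`.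

*Likelihood.* For a DAG, `det (R - Φ) = ∏ ρ_j`, so the likelihood is a function of `Θ(ν)` alone and
takes the same value at `ν*` and `ν₀` (`logLik_eq_of_Theta_eq`). It is Lipschitz near each of them
with a constant of order `n + ∑ ‖X_k‖²` (`exists_eventually_abs_logLik_sub_le`), which is `O_P(n)` by
Markov's inequality (`exists_forall_measure_sum_sq_le`). As `a_n = O(n^{-1/2})`, both estimators are
`O_P(n^{-1/2})`-close to their targets, and the likelihood difference is `O_P(n^{1/2})`.

*Penalty.* Concavity, `q 0 = 0` and `q t ≤ K t` make the penalty function `K`-Lipschitz on `[0, ∞)`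
(`le_add_mul_abs_sub`). Hence `pen(ν̂)` is at least `|E(ν₀)| (τ - O_P(n^{-1/2}))`, because `c_n(ν₀)`
is that close to `τ` (`le_penalty`), while `pen(ν̂*)` is at most `|E(ν*)| τ + O_P(n^{-1/2})`, the
entries off the support of `ν*` being of size `O_P(n^{-1/2})` (`penalty_le`).

As `ν₀` has at least one edge more, the penalties contribute `n τ - O_P(n^{1/2})`, and
`τ n^{1/2} → ∞` makes this dominate (`eventually_objective_lt`).
-/

namespace PenalizedDAG

variable {p : ℕ}

/-! ### Equivalent DAGs have equal likelihood -/

/-- A matrix whose off-diagonal support is acyclic has the product of its diagonal as determinant: a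
permutation other than the identity that contributes to the Leibniz formula would, along one of its
nontrivial cycles, give a directed cycle. -/
theorem det_eq_prod_diag_of_isDAG {A M : Matrix (Fin p) (Fin p) ℝ} (hA : IsDAG A)
    (hM : ∀ i j, i ≠ j → M i j ≠ 0 → A i j ≠ 0) : M.det = ∏ i, M i i := by
  rw [Matrix.det_apply, Finset.sum_eq_single 1]
  · simp
  · intro σ _ hσ
    suffices h : ∏ i, M (σ i) i = 0 by rw [h, smul_zero]
    by_contra hne
    have hne' : ∀ i, M (σ i) i ≠ 0 := fun i =>
      Finset.prod_ne_zero_iff.mp hne i (Finset.mem_univ i)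
    obtain ⟨i, hi⟩ : ∃ i, σ i ≠ i := by
      by_contra! h
      exact hσ (Equiv.ext h)
    have hstep : ∀ k : ℕ, A ((σ ^ (k + 1)) i) ((σ ^ k) i) ≠ 0 := by
      intro k
      rw [pow_succ', Equiv.Perm.mul_apply]
      refine hM _ _ (fun h => hi ?_) (hne' _)
      have h2 : (σ ^ k) (σ i) = (σ ^ k) i := by
        rw [← Equiv.Perm.mul_apply, ← pow_succ, pow_succ', Equiv.Perm.mul_apply, h]
      exact (σ ^ k).injective h2
    have hpath : ∀ k : ℕ, Relation.TransGen (fun k l => A k l ≠ 0) ((σ ^ (k + 1)) i) i := by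
      intro k
      induction k with
      | zero => exact Relation.TransGen.single (hstep 0)
      | succ k ih => exact Relation.TransGen.head (hstep (k + 1)) ih
    have h := hpath (orderOf σ - 1)
    rw [Nat.sub_add_cancel (orderOf_pos σ), pow_orderOf_eq_one] at h
    exact hA i h
  · simp

theorem Rmat_sub_Phi_apply (ν : Param p) (i j : Fin p) :
    (Rmat ν - Phi ν) i j = if i = j then ν (i, j) else -ν (i, j) := by
  by_cases h : i = j
  · subst h; simp [Rmat, Phi]
  · simp [Rmat, Phi, h]

theorem logLik_eq_sum {n : ℕ} (X : Matrix (Fin n) (Fin p) ℝ) (ν : Param p) :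
    logLik X ν = n * ∑ j, Real.log (ν (j, j))
      - 1 / 2 * ∑ j, ∑ k, (X * (Rmat ν - Phi ν)) k j ^ 2 := by
  rw [logLik, Finset.sum_sub_distrib, Finset.mul_sum, Finset.mul_sum]
  congr 1
  refine Finset.sum_congr rfl fun j _ => ?_
  rw [EuclideanSpace.norm_sq_eq]
  congr 1
  refine Finset.sum_congr rfl fun k _ => ?_
  rw [Real.norm_eq_abs, sq_abs, Matrix.mul_sub, Matrix.sub_apply, Rmat, Matrix.mul_diagonal,
    Matrix.mul_apply, mul_comm (X k j)]

theorem sum_log_diag_eq {ν : Param p} (hν : ν ∈ dagSpace p) :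
    ∑ j, Real.log (ν (j, j)) = 1 / 2 * Real.log (Theta ν).det := by
  have hdet : (Rmat ν - Phi ν).det = ∏ j, ν (j, j) := by
    rw [det_eq_prod_diag_of_isDAG hν.1]
    · exact Finset.prod_congr rfl fun j _ => by rw [Rmat_sub_Phi_apply, if_pos rfl]
    · intro i j hij h
      simpa [Rmat, hij] using h
  rw [Theta, Matrix.det_mul, Matrix.det_transpose, hdet, ← sq, Real.log_pow,
    Real.log_prod (fun j _ => (hν.2 j).ne')]
  push_cast
  ring

theorem sum_sq_eq_trace {n : ℕ} (X : Matrix (Fin n) (Fin p) ℝ) (ν : Param p) :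
    ∑ j, ∑ k, (X * (Rmat ν - Phi ν)) k j ^ 2 = (X * Theta ν * X.transpose).trace := by
  have : X * Theta ν * X.transpose =
      (X * (Rmat ν - Phi ν)) * (X * (Rmat ν - Phi ν)).transpose := by
    rw [Theta, Matrix.transpose_mul]
    simp only [Matrix.mul_assoc]
  rw [this, Matrix.trace, Finset.sum_comm]
  refine Finset.sum_congr rfl fun k _ => ?_
  rw [Matrix.diag_apply, Matrix.mul_apply]
  exact Finset.sum_congr rfl fun j _ => by rw [Matrix.transpose_apply, sq]

/-- The Gaussian likelihood depends on a DAG only through its inverse covariance, so equivalent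
DAGs have exactly the same likelihood. -/
theorem logLik_eq_of_Theta_eq {n : ℕ} (X : Matrix (Fin n) (Fin p) ℝ) {ν ν' : Param p}
    (hν : ν ∈ dagSpace p) (hν' : ν' ∈ dagSpace p) (h : Theta ν = Theta ν') :
    logLik X ν = logLik X ν' := by
  rw [logLik_eq_sum, logLik_eq_sum, sum_sq_eq_trace, sum_sq_eq_trace, sum_log_diag_eq hν,
    sum_log_diag_eq hν', h]

/-! ### Local Lipschitz bound for the likelihood -/

theorem sq_mul_Rmat_sub_Phi_le {n : ℕ} (X : Matrix (Fin n) (Fin p) ℝ) (ν : Param p)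
    (k : Fin n) (j : Fin p) :
    (X * (Rmat ν - Phi ν)) k j ^ 2 ≤ (∑ i, X k i ^ 2) * ‖ν‖ ^ 2 := by
  rw [Matrix.mul_apply]
  refine (Finset.sum_mul_sq_le_sq_mul_sq _ _ _).trans ?_
  refine mul_le_mul_of_nonneg_left ?_ (Finset.sum_nonneg fun i _ => sq_nonneg _)
  rw [EuclideanSpace.norm_sq_eq, Fintype.sum_prod_type_right]
  calc ∑ i, (Rmat ν - Phi ν) i j ^ 2 = ∑ i, ‖ν (i, j)‖ ^ 2 := by
        refine Finset.sum_congr rfl fun i _ => ?_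
        rw [Rmat_sub_Phi_apply, Real.norm_eq_abs, sq_abs]
        split_ifs <;> ring
    _ ≤ _ := Finset.single_le_sum (f := fun j => ∑ i, ‖ν (i, j)‖ ^ 2)
        (fun j _ => Finset.sum_nonneg fun i _ => sq_nonneg _) (Finset.mem_univ j)

theorem Rmat_sub_Phi_add (ν ν' : Param p) :
    Rmat (ν + ν') - Phi (ν + ν') = (Rmat ν - Phi ν) + (Rmat ν' - Phi ν') := by
  ext i j
  rw [Rmat_sub_Phi_apply, Matrix.add_apply, Rmat_sub_Phi_apply, Rmat_sub_Phi_apply,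
    PiLp.add_apply]
  split_ifs <;> ring

theorem Rmat_sub_Phi_sub (ν ν' : Param p) :
    Rmat (ν - ν') - Phi (ν - ν') = (Rmat ν - Phi ν) - (Rmat ν' - Phi ν') := by
  ext i j
  rw [Rmat_sub_Phi_apply, Matrix.sub_apply, Rmat_sub_Phi_apply, Rmat_sub_Phi_apply,
    PiLp.sub_apply]
  split_ifs <;> ring

theorem abs_sum_sq_sub_le {n : ℕ} (X : Matrix (Fin n) (Fin p) ℝ) (ν ν' : Param p) :
    |∑ j, ∑ k, (X * (Rmat ν' - Phi ν')) k j ^ 2 - ∑ j, ∑ k, (X * (Rmat ν - Phi ν)) k j ^ 2| ≤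
      p * ((∑ k, ∑ i, X k i ^ 2) * (‖ν' - ν‖ * ‖ν' + ν‖)) := by
  have hterm : ∀ (j : Fin p) (k : Fin n),
      |(X * (Rmat ν' - Phi ν')) k j ^ 2 - (X * (Rmat ν - Phi ν)) k j ^ 2| ≤
        (∑ i, X k i ^ 2) * (‖ν' - ν‖ * ‖ν' + ν‖) := by
    intro j k
    have h1 := sq_mul_Rmat_sub_Phi_le X (ν' - ν) k j
    have h2 := sq_mul_Rmat_sub_Phi_le X (ν' + ν) k j
    rw [Rmat_sub_Phi_sub, Matrix.mul_sub, Matrix.sub_apply] at h1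
    rw [Rmat_sub_Phi_add, Matrix.mul_add, Matrix.add_apply] at h2
    have hs : 0 ≤ ∑ i, X k i ^ 2 := Finset.sum_nonneg fun i _ => sq_nonneg _
    refine abs_le_of_sq_le_sq ?_ (by positivity)
    calc _ = ((X * (Rmat ν' - Phi ν')) k j - (X * (Rmat ν - Phi ν)) k j) ^ 2 *
          ((X * (Rmat ν' - Phi ν')) k j + (X * (Rmat ν - Phi ν)) k j) ^ 2 := by ring
      _ ≤ _ := mul_le_mul h1 h2 (sq_nonneg _) (by positivity)
      _ = _ := by ring
  rw [← Finset.sum_sub_distrib]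
  simp_rw [← Finset.sum_sub_distrib]
  refine (Finset.abs_sum_le_sum_abs _ _).trans ?_
  calc _ ≤ ∑ _j : Fin p, (∑ k, ∑ i, X k i ^ 2) * (‖ν' - ν‖ * ‖ν' + ν‖) := by
        refine Finset.sum_le_sum fun j _ => (Finset.abs_sum_le_sum_abs _ _).trans ?_
        rw [Finset.sum_mul]
        exact Finset.sum_le_sum fun k _ => hterm j k
    _ = _ := by simp

/-- Near a parameter with positive diagonal, the log-likelihood is Lipschitz with a constant of the
order of the sample size plus the sum of squares of the data. This crude bound takes the place of
a second-order expansion. -/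
theorem exists_eventually_abs_logLik_sub_le {ν : Param p} (hν : ∀ j, 0 < ν (j, j)) :
    ∃ L : ℝ, 0 ≤ L ∧ ∀ᶠ ν' in 𝓝 ν, ∀ (n : ℕ) (X : Matrix (Fin n) (Fin p) ℝ),
      |logLik X ν' - logLik X ν| ≤ L * (n + ∑ k, ∑ i, X k i ^ 2) * ‖ν' - ν‖ := by
  have hdiff : DifferentiableAt ℝ (fun ν' : Param p => ∑ j, Real.log (ν' (j, j))) ν := by
    refine DifferentiableAt.fun_sum fun j _ => DifferentiableAt.log ?_ (hν j).ne'
    fun_prop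
  obtain ⟨L₁, hL₁, hlog⟩ := hdiff.isBigO_sub.exists_nonneg
  have hball : ∀ᶠ ν' in 𝓝 ν, ‖ν' + ν‖ < ‖ν + ν‖ + 1 :=
    (continuous_norm.comp (continuous_add_const ν)).continuousAt.eventually_lt_const
      (by simp)
  refine ⟨L₁ + p * (‖ν + ν‖ + 1), by positivity, ?_⟩
  filter_upwards [hlog.bound, hball] with ν' h1 h2 n X
  rw [Real.norm_eq_abs] at h1
  have h3 := abs_sum_sq_sub_le X ν ν'
  rw [logLik_eq_sum, logLik_eq_sum]
  set S := ∑ k, ∑ i, X k i ^ 2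
  have hS : 0 ≤ S := Finset.sum_nonneg fun _ _ => Finset.sum_nonneg fun _ _ => sq_nonneg _
  set Q' := ∑ j, ∑ k, (X * (Rmat ν' - Phi ν')) k j ^ 2
  set Q := ∑ j, ∑ k, (X * (Rmat ν - Phi ν)) k j ^ 2
  set l' := ∑ j, Real.log (ν' (j, j))
  set l := ∑ j, Real.log (ν (j, j))
  have h4 : |n * l' - 1 / 2 * Q' - (n * l - 1 / 2 * Q)| ≤ n * |l' - l| + 1 / 2 * |Q' - Q| := by
    rw [show (n : ℝ) * l' - 1 / 2 * Q' - (n * l - 1 / 2 * Q) =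
      n * (l' - l) - 1 / 2 * (Q' - Q) by ring]
    refine (abs_sub _ _).trans ?_
    rw [abs_mul, abs_mul, Nat.abs_cast, abs_of_pos (by norm_num : (0 : ℝ) < 1 / 2)]
  have h5 : (n : ℝ) * |l' - l| ≤ n * (L₁ * ‖ν' - ν‖) := by gcongr
  have h6 : p * (S * (‖ν' - ν‖ * ‖ν' + ν‖)) ≤ p * (S * (‖ν' - ν‖ * (‖ν + ν‖ + 1))) := by
    gcongr
  have h7 : 0 ≤ (n : ℝ) * (p * (‖ν + ν‖ + 1) * ‖ν' - ν‖) := by positivity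
  have h8 : 0 ≤ L₁ * S * ‖ν' - ν‖ := by positivity
  have h9 : 0 ≤ p * (S * (‖ν' - ν‖ * (‖ν + ν‖ + 1))) := by positivity
  linarith

/-! ### Bounds for the penalty -/

theorem slope_nonneg {q : ℝ → ℝ} (hmono : MonotoneOn q (Ici 0)) (hzero : q 0 = 0) {K : ℝ}
    (hK : ∀ t, 0 ≤ t → q t ≤ K * t) : 0 ≤ K := by
  have h1 := hmono (a := 0) (b := 1) (by simp) (by simp) zero_le_one
  have h2 := hK 1 zero_le_one
  linarith

/-- A concave penalty with `q 0 = 0` that lies below the line of slope `K` is `K`-Lipschitz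
(here in one-sided form, for either order of `s` and `t`). -/
theorem le_add_mul_abs_sub {q : ℝ → ℝ} (hmono : MonotoneOn q (Ici 0))
    (hconc : ConcaveOn ℝ (Ici 0) q) (hzero : q 0 = 0) {K : ℝ} (hK : ∀ t, 0 ≤ t → q t ≤ K * t)
    {s t : ℝ} (hs : 0 ≤ s) (ht : 0 ≤ t) : q s ≤ q t + K * |s - t| := by
  have hK0 : 0 ≤ K := slope_nonneg hmono hzero hK
  rcases le_or_gt s t with h | h
  · have h1 := hmono hs ht h
    have h2 : 0 ≤ K * |s - t| := by positivity
    linarith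
  · have hs0 : 0 < s := ht.trans_lt h
    -- concavity between `0` and `s` gives `q t ≥ (t / s) * q s`
    have h0 : 0 ≤ 1 - t / s := by rw [sub_nonneg, div_le_one hs0]; exact h.le
    have h1 := hconc.2 (mem_Ici.mpr (le_refl (0 : ℝ))) (mem_Ici.mpr hs) h0
      (div_nonneg ht hs) (sub_add_cancel 1 (t / s))
    simp only [smul_eq_mul, mul_zero, zero_add, hzero, div_mul_cancel₀ t hs0.ne'] at h1
    have h2 : (1 - t / s) * q s ≤ (1 - t / s) * (K * s) :=
      mul_le_mul_of_nonneg_left (hK s hs) h0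
    have h3 : (1 - t / s) * (K * s) = K * (s - t) := by field_simp
    rw [abs_of_pos (sub_pos.mpr h)]
    linarith

theorem abs_abs_sub_abs_le (ν ν' : Param p) (e : Fin p × Fin p) :
    |(|ν e| - |ν' e|)| ≤ ‖ν' - ν‖ := by
  refine (abs_abs_sub_abs_le_abs_sub _ _).trans ?_
  rw [abs_sub_comm]
  simpa using PiLp.norm_apply_le (ν' - ν) e

theorem mem_edges {ν : Param p} {e : Fin p × Fin p} :
    e ∈ edges ν ↔ e.1 ≠ e.2 ∧ ν e ≠ 0 := by
  simp [edges, Phi]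

open Classical in
theorem numEdges_eq_card (ν : Param p) : numEdges ν = (edges ν).toFinset.card :=
  Set.ncard_eq_toFinset_card' _

theorem cMin_le {q : ℝ → ℝ} {ν : Param p} {e : Fin p × Fin p} (he : e ∈ edges ν) :
    cMin q ν ≤ q |ν e| := by
  have h := ciInf_le (f := fun e : edges ν => q (abs (Phi ν e.1.1 e.1.2)))
    (Set.finite_range _).bddBelow ⟨e, he⟩
  simpa [cMin, Phi, (mem_edges.mp he).1] using h

/-- Near `ν`, the edges of `ν` alone contribute almost `cMin q ν` each. -/
theorem le_penalty {q : ℝ → ℝ} {K : ℝ} (hmono : MonotoneOn q (Ici 0)) (hconc : ConcaveOn ℝ (Ici 0) q)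
    (hzero : q 0 = 0) (hK : ∀ t, 0 ≤ t → q t ≤ K * t) (ν ν' : Param p) :
    numEdges ν * (cMin q ν - K * ‖ν' - ν‖) ≤ penalty q ν' := by
  classical
  have hK0 : 0 ≤ K := slope_nonneg hmono hzero hK
  have hnonneg : ∀ t, 0 ≤ t → 0 ≤ q t := fun t ht => by
    simpa [hzero] using hmono (a := 0) (b := t) (by simp) ht ht
  rw [numEdges_eq_card, ← nsmul_eq_mul, ← Finset.sum_const, penalty]
  refine (Finset.sum_le_sum (g := fun e => if e.1 = e.2 then 0 else q |ν' e|) ?_).trans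
    (Finset.sum_le_sum_of_subset_of_nonneg (Finset.subset_univ _) ?_)
  · intro e he
    rw [Set.mem_toFinset] at he
    rw [if_neg (mem_edges.mp he).1]
    have h1 := le_add_mul_abs_sub hmono hconc hzero hK (abs_nonneg (ν e)) (abs_nonneg (ν' e))
    have h2 := mul_le_mul_of_nonneg_left (abs_abs_sub_abs_le ν ν' e) hK0
    have h3 := cMin_le (q := q) he
    linarith
  · intro e _ _
    split_ifs
    · exact le_rfl
    · exact hnonneg _ (abs_nonneg _)

/-- Near `ν`, the edges of `ν` contribute at most `T` each, and all other entries are small. -/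
theorem penalty_le {q : ℝ → ℝ} {K : ℝ} (hmono : MonotoneOn q (Ici 0)) (hzero : q 0 = 0)
    (hK : ∀ t, 0 ≤ t → q t ≤ K * t) {T : ℝ}
    (hT : ∀ t, 0 ≤ t → q t ≤ T) (ν ν' : Param p) :
    penalty q ν' ≤ numEdges ν * T + p ^ 2 * (K * ‖ν' - ν‖) := by
  classical
  have hK0 : 0 ≤ K := slope_nonneg hmono hzero hK
  have hKd : 0 ≤ K * ‖ν' - ν‖ := by positivity
  have hterm : ∀ e : Fin p × Fin p, (if e.1 = e.2 then 0 else q |ν' e|) ≤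
      (if e ∈ (edges ν).toFinset then T else 0) + K * ‖ν' - ν‖ := by
    intro e
    have hT0 : 0 ≤ T := hzero ▸ hT 0 le_rfl
    have h1 := hT _ (abs_nonneg (ν' e))
    by_cases hd : e.1 = e.2
    · rw [if_pos hd]
      split_ifs <;> linarith
    rw [if_neg hd]
    split_ifs with he
    · linarith
    · rw [Set.mem_toFinset, mem_edges] at he
      have he0 : ν e = 0 := by
        by_contra h
        exact he ⟨hd, h⟩
      have h2 := abs_abs_sub_abs_le ν ν' e
      rw [he0, abs_zero, zero_sub, abs_neg, abs_abs] at h2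
      have h3 := hK _ (abs_nonneg (ν' e))
      have h4 := mul_le_mul_of_nonneg_left h2 hK0
      linarith
  refine (Finset.sum_le_sum fun e _ => hterm e).trans (le_of_eq ?_)
  rw [Finset.sum_add_distrib, Finset.sum_ite_mem, Finset.univ_inter, Finset.sum_const,
    Finset.sum_const, numEdges_eq_card]
  simp [sq]

theorem le_toReal_tau {q : ℝ → ℝ} (h : tau q < ⊤) {t : ℝ} (ht : 0 ≤ t) :
    q t ≤ (tau q).toReal := by
  have h1 : ((q t : ℝ) : EReal) ≤ tau q := le_iSup₂_of_le t ht le_rfl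
  have h2 : tau q ≠ ⊥ := fun hb => by simp [hb] at h1
  rwa [← EReal.coe_toReal h.ne h2, EReal.coe_le_coe_iff] at h1

/-! ### Stochastic bounds at the rate `n^{-1/2}` -/

theorem rate_eq (n : ℕ) : rate n = (Real.sqrt n)⁻¹ := by
  rw [rate, Real.sqrt_eq_rpow, ← Real.rpow_neg (Nat.cast_nonneg n)]

theorem rate_nonneg (n : ℕ) : 0 ≤ rate n := by
  rw [rate_eq]; positivity

theorem tendsto_rate : Tendsto rate atTop (𝓝 0) := by
  simp_rw [funext rate_eq]
  exact (Real.tendsto_sqrt_atTop.comp tendsto_natCast_atTop_atTop).inv_tendsto_atTop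

/-- Since `a_n(ν) = O(n^{-1/2})`, the estimators converge at the plain rate `n^{-1/2}`. -/
theorem IsConsistentLocalMax.exists_eventually_le {Ω : Type*} [MeasurableSpace Ω] {P : Measure Ω}
    {X : ℕ → Ω → EuclideanSpace ℝ (Fin p)} {q : ℕ → ℝ → ℝ} {ν : Param p}
    {νhat : ℕ → Ω → Param p} (h : IsConsistentLocalMax P X q ν νhat)
    (ha : (fun n => aMax (q n) ν) =O[atTop] rate) {ε : ENNReal} (hε : 0 < ε) :
    ∃ C : ℝ, ∀ᶠ n in atTop, P {ω | C * rate n < ‖νhat n ω - ν‖} ≤ ε := by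
  obtain ⟨C, hC⟩ := h.consistent ε hε
  obtain ⟨A, hA⟩ := ha.bound
  refine ⟨|C| * (1 + A), ?_⟩
  filter_upwards [hC, hA] with n h1 h2
  refine (measure_mono fun ω hω => ?_).trans h1
  rw [mem_ofPred_eq] at hω ⊢
  rw [abs_norm]
  rw [Real.norm_eq_abs, Real.norm_eq_abs, abs_of_nonneg (rate_nonneg n)] at h2
  refine lt_of_le_of_lt ?_ hω
  calc C * (rate n + aMax (q n) ν) ≤ |C| * |rate n + aMax (q n) ν| := by
        rw [← abs_mul]; exact le_abs_self _
    _ ≤ |C| * ((1 + A) * rate n) := by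
        gcongr
        refine (abs_add_le _ _).trans ?_
        rw [abs_of_nonneg (rate_nonneg n)]
        linarith
    _ = _ := by ring

/-- By Markov's inequality, the sum of squares of the data is `O_P(n)`. -/
theorem exists_forall_measure_sum_sq_le {Ω : Type*} [MeasurableSpace Ω] {P : Measure Ω}
    {S₀ : Matrix (Fin p) (Fin p) ℝ} {X : ℕ → Ω → EuclideanSpace ℝ (Fin p)}
    (hX : ∀ k, HasLaw (X k) (multivariateGaussian 0 S₀) P) {ε : ENNReal} (hε : 0 < ε) :
    ∃ C : ℝ, ∀ n : ℕ, 0 < n →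
      P {ω | C * n < ∑ k, ∑ i, dataMatrix X n ω k i ^ 2} ≤ ε := by
  set M : ENNReal := ∫⁻ x, ‖x‖ₑ ^ 2 ∂(multivariateGaussian 0 S₀) with hM
  have hM_top : M ≠ ⊤ := by
    have h := (IsGaussian.memLp_two_id (μ := multivariateGaussian 0 S₀)).eLpNorm_lt_top
    have h2 := (eLpNorm_lt_top_iff_lintegral_rpow_enorm_lt_top two_ne_zero ENNReal.ofNat_ne_top).mp h
    simpa using h2.ne
  have hmoment : ∀ k, ∫⁻ ω, ‖X k ω‖ₑ ^ 2 ∂P = M := fun k => by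
    rw [hM, ← (hX k).map_eq, lintegral_map' (by fun_prop) (hX k).aemeasurable]
  obtain ⟨C, hCε, hC0⟩ : ∃ C : NNReal, M ≤ C * ε ∧ 0 < C := by
    by_cases hε' : ε = ⊤
    · exact ⟨1, by simp [hε'], one_pos⟩
    · refine ⟨(M / ε).toNNReal + 1, ?_, by positivity⟩
      rw [ENNReal.coe_add, ENNReal.coe_toNNReal (ENNReal.div_ne_top hM_top hε.ne'), add_mul,
        ENNReal.div_mul_cancel hε.ne' hε']
      exact le_self_add
  refine ⟨C, fun n hn => ?_⟩
  have hnC : (C : ENNReal) * n ≠ 0 := by simp [hC0.ne', hn.ne']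
  have hnC' : (C : ENNReal) * n ≠ ⊤ := ENNReal.mul_ne_top ENNReal.coe_ne_top (ENNReal.natCast_ne_top n)
  have hsub : {ω | C * n < ∑ k, ∑ i, dataMatrix X n ω k i ^ 2} ⊆
      {ω | (C : ENNReal) * n ≤ ∑ k : Fin n, ‖X k ω‖ₑ ^ 2} := by
    intro ω hω
    rw [mem_ofPred_eq] at hω ⊢
    have h1 : ∑ k, ∑ i, dataMatrix X n ω k i ^ 2 = ∑ k : Fin n, ‖X k ω‖ ^ 2 := by
      refine Finset.sum_congr rfl fun k _ => ?_
      rw [EuclideanSpace.norm_sq_eq]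
      exact Finset.sum_congr rfl fun i _ => by rw [Real.norm_eq_abs, sq_abs]; rfl
    rw [h1] at hω
    have h2 := ENNReal.ofReal_le_ofReal hω.le
    rw [ENNReal.ofReal_mul C.coe_nonneg, ENNReal.ofReal_coe_nnreal, ENNReal.ofReal_natCast,
      ENNReal.ofReal_sum_of_nonneg fun _ _ => sq_nonneg _] at h2
    simpa [ENNReal.ofReal_pow] using h2
  refine (measure_mono hsub).trans ?_
  have hmarkov := meas_ge_le_lintegral_div (μ := P)
    (f := fun ω => ∑ k : Fin n, ‖X k ω‖ₑ ^ 2)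
    (Finset.aemeasurable_fun_sum _ fun k _ => (hX k).aemeasurable.enorm.pow_const 2) hnC hnC'
  refine hmarkov.trans (ENNReal.div_le_of_le_mul ?_)
  rw [lintegral_finsetSum' (f := fun (k : Fin n) ω => ‖X k ω‖ₑ ^ 2) _ fun k _ =>
    (hX k).aemeasurable.enorm.pow_const 2]
  simp only [hmoment, Finset.sum_const, Finset.card_univ, Fintype.card_fin, nsmul_eq_mul]
  calc (n : ENNReal) * M ≤ n * (C * ε) := by gcongr
    _ = ε * (C * n) := by ring

/-! ### Comparison of the two penalized likelihoods -/

/-- The deterministic core: once `ν₁` and `ν₂` are within `C n^{-1/2}` of two equivalent DAGs and the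
data have sum of squares at most `C n`, the likelihoods differ by `O(n^{1/2})` only, and the penalty
of the extra edges, of order `n τ(λ_n) ≫ n^{1/2}`, decides. -/
theorem eventually_objective_lt {Θ₀ : Matrix (Fin p) (Fin p) ℝ} {pen : ℕ → ℝ → ℝ}
    (hmono : ∀ n, MonotoneOn (pen n) (Ici 0)) (hconc : ∀ n, ConcaveOn ℝ (Ici 0) (pen n))
    (hzero : ∀ n, pen n 0 = 0)
    (hslope : ∃ K : ℝ, ∀ᶠ n in atTop, ∀ t : ℝ, 0 ≤ t → pen n t ≤ K * t)
    (htau_bdd : limsup (fun n => tau (pen n)) atTop < ⊤)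
    (htau_rate : Tendsto (fun n => (tau (pen n)).toReal * Real.sqrt n) atTop atTop)
    {νstar ν₀ : Param p} (hstar : νstar ∈ equivClass Θ₀) (hν₀ : ν₀ ∈ equivClass Θ₀)
    (hmore : numEdges νstar < numEdges ν₀) (hflat₀ : NearlyFlatAt pen ν₀) (C : ℝ) :
    ∀ᶠ n : ℕ in atTop, ∀ (X : Matrix (Fin n) (Fin p) ℝ) (ν₁ ν₂ : Param p),
      ‖ν₁ - νstar‖ ≤ C * rate n → ‖ν₂ - ν₀‖ ≤ C * rate n → ∑ k, ∑ i, X k i ^ 2 ≤ C * n →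
      objective (pen n) X ν₂ < objective (pen n) X ν₁ := by
  have hne : (edges ν₀).Nonempty := by
    rw [Set.nonempty_iff_ne_empty]
    intro h
    rw [numEdges, numEdges, h, Set.ncard_empty] at hmore
    exact absurd hmore (Nat.not_lt_zero _)
  obtain ⟨K, hK⟩ := hslope
  obtain ⟨B, hB⟩ := (hflat₀ hne).bound
  obtain ⟨L₁, hL₁, hlik₁⟩ := exists_eventually_abs_logLik_sub_le hstar.1.2
  obtain ⟨L₂, hL₂, hlik₂⟩ := exists_eventually_abs_logLik_sub_le hν₀.1.2
  obtain ⟨d₁, hd₁, hlik₁⟩ := Metric.eventually_nhds_iff.mp hlik₁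
  obtain ⟨d₂, hd₂, hlik₂⟩ := Metric.eventually_nhds_iff.mp hlik₂
  have hCrate : Tendsto (fun n => C * rate n) atTop (𝓝 0) := by
    simpa using tendsto_rate.const_mul C
  set m : ℝ := (numEdges ν₀ : ℝ) with hm
  -- the total of all error terms, in units of `n * n^{-1/2}`
  set D : ℝ := (L₁ + L₂) * (1 + C) * C + p ^ 2 * (K * C) + m * (B + K * C)
  filter_upwards [hK, hB, eventually_lt_of_limsup_lt htau_bdd, hCrate.eventually_lt_const hd₁,
    hCrate.eventually_lt_const hd₂, htau_rate.eventually_gt_atTop D, eventually_gt_atTop 0]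
    with n hK hB htop hr₁ hr₂ hD hn X ν₁ ν₂ h₁ h₂ hX
  have hn' : (0 : ℝ) < n := Nat.cast_pos.mpr hn
  have hr := rate_nonneg n
  have hK0 : 0 ≤ K := slope_nonneg (hmono n) (hzero n) hK
  have hT := fun t ht => le_toReal_tau (q := pen n) htop (t := t) ht
  set T := (tau (pen n)).toReal
  have hT0 : 0 ≤ T := hzero n ▸ hT 0 le_rfl
  have hDT : D * rate n < T := by
    rw [rate_eq, ← div_eq_mul_inv, div_lt_iff₀ (Real.sqrt_pos.mpr hn')]
    exact hD
  have hS0 : 0 ≤ ∑ k, ∑ i, X k i ^ 2 :=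
    Finset.sum_nonneg fun _ _ => Finset.sum_nonneg fun _ _ => sq_nonneg _
  have hl₁ := (abs_le.mp (hlik₁ (y := ν₁) (by rw [dist_eq_norm]; linarith) n X)).1
  have hl₂ := (abs_le.mp (hlik₂ (y := ν₂) (by rw [dist_eq_norm]; linarith) n X)).2
  have hb : ∀ L : ℝ, 0 ≤ L → ∀ d : ℝ, 0 ≤ d → d ≤ C * rate n →
      L * (n + ∑ k, ∑ i, X k i ^ 2) * d ≤ n * (L * (1 + C) * C * rate n) := by
    intro L hL d hd0 hd
    have hCn : 0 ≤ C * (n : ℝ) := hS0.trans hX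
    calc L * (n + ∑ k, ∑ i, X k i ^ 2) * d ≤ L * (n + C * n) * (C * rate n) := by
          refine mul_le_mul (by gcongr) hd hd0 (by positivity)
      _ = _ := by ring
  have hb₁ := hb L₁ hL₁ _ (norm_nonneg _) h₁
  have hb₂ := hb L₂ hL₂ _ (norm_nonneg _) h₂
  have heq := logLik_eq_of_Theta_eq X hstar.1 hν₀.1 (hstar.2.trans hν₀.2.symm)
  have hp₁ : penalty (pen n) ν₁ ≤ numEdges νstar * T + p ^ 2 * (K * (C * rate n)) := by
    refine (penalty_le (hmono n) (hzero n) hK hT νstar ν₁).trans ?_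
    gcongr
  have hp₂ : m * (T - B * rate n - K * (C * rate n)) ≤ penalty (pen n) ν₂ := by
    refine le_trans ?_ (le_penalty (hmono n) (hconc n) (hzero n) hK ν₀ ν₂)
    rw [Real.norm_eq_abs, Real.norm_eq_abs, abs_of_nonneg hr] at hB
    have := (abs_le.mp hB).1
    rw [← hm]
    gcongr
    linarith
  have hedge : (numEdges νstar : ℝ) + 1 ≤ m := by rw [hm]; exact_mod_cast hmore
  have hgap : (numEdges νstar : ℝ) * T + T ≤ m * T := by nlinarith
  have hpen : (L₁ + L₂) * (1 + C) * C * rate n <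
      penalty (pen n) ν₂ - penalty (pen n) ν₁ := by
    have hDeq : D * rate n = (L₁ + L₂) * (1 + C) * C * rate n + p ^ 2 * (K * (C * rate n))
      + m * (B * rate n + K * (C * rate n)) := by ring
    linarith
  have hfin := mul_lt_mul_of_pos_left hpen hn'
  rw [objective, objective]
  linarith

end PenalizedDAG

theorem theorem3 {p : ℕ}
    {Ω : Type*} [MeasurableSpace Ω] (P : MeasureTheory.Measure Ω)
    [MeasureTheory.IsProbabilityMeasure P]
    -- the observations are i.i.d. with law `N(0, Σ₀)`
    (S₀ : Matrix (Fin p) (Fin p) ℝ) (hS₀ : S₀.PosDef)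
    (X : ℕ → Ω → EuclideanSpace ℝ (Fin p))
    (hX_indep : ProbabilityTheory.iIndepFun X P)
    (hX_law : ∀ k, ProbabilityTheory.HasLaw (X k) (ProbabilityTheory.multivariateGaussian 0 S₀) P)
    -- the penalties `pen n = p_{λ_n}` and the tuning parameters `λ_n = lam n`
    (pen : ℕ → ℝ → ℝ) (lam : ℕ → ℝ)
    (hpen_mono : ∀ n, MonotoneOn (pen n) (Set.Ici 0))
    (hpen_concave : ∀ n, ConcaveOn ℝ (Set.Ici 0) (pen n))
    (hpen_zero : ∀ n, pen n 0 = 0)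
    (hpen_slope : ∃ K : ℝ, ∀ᶠ n in Filter.atTop, ∀ t : ℝ, 0 ≤ t → pen n t ≤ K * t)
    (hpen_liminf : 0 < Filter.liminf (fun n => Filter.liminf
      (fun t : ℝ => ((deriv (pen n) t / lam n : ℝ) : EReal)) (nhdsWithin 0 (Set.Ioi 0)))
      Filter.atTop)
    (hlam_zero : Filter.Tendsto lam Filter.atTop (nhds 0))
    (hlam_rate : Filter.Tendsto (fun n => lam n * Real.sqrt n) Filter.atTop Filter.atTop)
    (htau_bdd : Filter.limsup (fun n => PenalizedDAG.tau (pen n)) Filter.atTop < ⊤)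
    (htau_rate : Filter.Tendsto (fun n => (PenalizedDAG.tau (pen n)).toReal * Real.sqrt n)
      Filter.atTop Filter.atTop)
    -- a sparsest DAG and an equivalent DAG with strictly more edges
    (νstar ν₀ : PenalizedDAG.Param p)
    (hstar : PenalizedDAG.IsSparsest S₀⁻¹ νstar)
    (hν₀ : ν₀ ∈ PenalizedDAG.equivClass S₀⁻¹)
    (hmore : PenalizedDAG.numEdges νstar < PenalizedDAG.numEdges ν₀)
    (hsmooth_star : PenalizedDAG.SmoothAt pen νstar)
    (hsmooth₀ : PenalizedDAG.SmoothAt pen ν₀)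
    (hflat_star : PenalizedDAG.NearlyFlatAt pen νstar)
    (hflat₀ : PenalizedDAG.NearlyFlatAt pen ν₀)
    -- the corresponding local maximizers
    (νhatstar νhat : ℕ → Ω → PenalizedDAG.Param p)
    (hhatstar : PenalizedDAG.IsConsistentLocalMax P X pen νstar νhatstar)
    (hhat : PenalizedDAG.IsConsistentLocalMax P X pen ν₀ νhat) :
    Filter.Tendsto (fun n => P {ω |
      PenalizedDAG.objective (pen n) (PenalizedDAG.dataMatrix X n ω) (νhat n ω) <
        PenalizedDAG.objective (pen n) (PenalizedDAG.dataMatrix X n ω) (νhatstar n ω)})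
      Filter.atTop (nhds 1) := by
  open PenalizedDAG MeasureTheory Filter in
  have hbad : Tendsto (fun n => P {ω | ¬ objective (pen n) (dataMatrix X n ω) (νhat n ω) <
      objective (pen n) (dataMatrix X n ω) (νhatstar n ω)}) atTop (nhds 0) := by
    rw [ENNReal.tendsto_nhds_zero]
    intro ε hε
    have hε3 : 0 < ε / 3 := ENNReal.div_pos hε.ne' (by simp)
    obtain ⟨C₁, hC₁⟩ := hhatstar.exists_eventually_le hsmooth_star.a_rate hε3
    obtain ⟨C₂, hC₂⟩ := hhat.exists_eventually_le hsmooth₀.a_rate hε3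
    obtain ⟨C₃, hC₃⟩ := exists_forall_measure_sum_sq_le hX_law hε3
    filter_upwards [hC₁, hC₂, eventually_gt_atTop 0,
      eventually_objective_lt hpen_mono hpen_concave hpen_zero hpen_slope htau_bdd htau_rate
        hstar.1 hν₀ hmore hflat₀ (max C₁ (max C₂ C₃))] with n h₁ h₂ hn hlt
    have hsub : {ω | ¬ objective (pen n) (dataMatrix X n ω) (νhat n ω) <
        objective (pen n) (dataMatrix X n ω) (νhatstar n ω)} ⊆
        ({ω | C₁ * rate n < ‖νhatstar n ω - νstar‖} ∪ {ω | C₂ * rate n < ‖νhat n ω - ν₀‖}) ∪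
          {ω | C₃ * n < ∑ k, ∑ i, dataMatrix X n ω k i ^ 2} := by
      intro ω hω
      by_contra hcon
      simp only [Set.mem_union, Set.mem_ofPred_eq, not_or, not_lt] at hcon
      obtain ⟨⟨g₁, g₂⟩, g₃⟩ := hcon
      refine hω (hlt _ _ _ (g₁.trans ?_) (g₂.trans ?_) (g₃.trans ?_))
      · exact mul_le_mul_of_nonneg_right (le_max_left _ _) (rate_nonneg n)
      · exact mul_le_mul_of_nonneg_right ((le_max_left _ _).trans (le_max_right _ _))
          (rate_nonneg n)
      · exact mul_le_mul_of_nonneg_right ((le_max_right _ _).trans (le_max_right _ _))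
          (Nat.cast_nonneg n)
    calc _ ≤ _ := measure_mono hsub
      _ ≤ _ := (measure_union_le _ _).trans (add_le_add_left (measure_union_le _ _) _)
      _ ≤ ε / 3 + ε / 3 + ε / 3 := add_le_add (add_le_add h₁ h₂) (hC₃ n hn)
      _ = ε := ENNReal.add_thirds ε
  -- subadditivity of the outer measure makes measurability of the event unnecessary
  have hlower : ∀ n, 1 - P {ω | ¬ PenalizedDAG.objective (pen n) (PenalizedDAG.dataMatrix X n ω)
      (νhat n ω) < PenalizedDAG.objective (pen n) (PenalizedDAG.dataMatrix X n ω)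
        (νhatstar n ω)} ≤ P {ω | PenalizedDAG.objective (pen n) (PenalizedDAG.dataMatrix X n ω)
      (νhat n ω) < PenalizedDAG.objective (pen n) (PenalizedDAG.dataMatrix X n ω)
        (νhatstar n ω)} := by
    intro n
    rw [tsub_le_iff_right, ← MeasureTheory.measure_univ (μ := P)]
    refine (MeasureTheory.measure_mono fun ω _ => ?_).trans (MeasureTheory.measure_union_le _ _)
    exact em _
  refine tendsto_of_tendsto_of_tendsto_of_le_of_le ?_ tendsto_const_nhds hlower
    fun n => MeasureTheory.prob_le_one
  simpa using ENNReal.Tendsto.sub tendsto_const_nhds hbad (Or.inl ENNReal.one_ne_top)
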